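/- All graphs are finite and simple. A graph is 2-connected if it has at least three vertices, is connected, and remains connected after the deletion of any single vertex. Theorem. Let $G$ be a 2-connected graph on $n$ vertices and let $C$ be a longest cycle in $G$, of length $c$, where $10\le c\le n-1$. Let $G-C$ be the graph obtained from $G$ by deleting all vertices of $C$, let $e(G-C)$ be its number of edges, and let $e(G-C,C)$ be the number of edges of $G$ with one endpoint in $V(G)\setminus V(C)$ and the other in $V(C)$. If $$e(G-C)+e(G-C,C)>\left(\left\lfloor\frac{c}{2}\right\rfloor-1\right)(n-c),$$ then there exists a vertex $u$ of $G-C$ that is isolated in $G-C$ and has exactly $\left\lfloor\frac{c}{2}\right\rfloor$ neighbours in $V(C)$. -/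

import Mathlib

namespace SimpleGraph

variable {V : Type*}

/-- `G` is 2-connected: it has at least three vertices, it is connected, and it stays connected
when any single vertex is deleted. -/
def IsTwoConnected (G : SimpleGraph V) : Prop :=
  3 ≤ ENat.card V ∧ G.Connected ∧ ∀ v : V, (G.induce {v}ᶜ).Connected

/-- The closed walk `C` is a longest cycle of `G`. -/
def Walk.IsLongestCycle {G : SimpleGraph V} {v : V} (C : G.Walk v v) : Prop :=
  C.IsCycle ∧ ∀ (w : V) (D : G.Walk w w), D.IsCycle → D.length ≤ C.length

/-- The vertex set of a walk. -/
def Walk.verts {G : SimpleGraph V} {v w : V} (C : G.Walk v w) : Set V :=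
  {x | x ∈ C.support}

/-- The number of edges `e(G)`, for a finite graph. -/
noncomputable def numEdges (G : SimpleGraph V) : ℕ :=
  G.edgeSet.ncard

/-- `G - S`: the graph obtained from `G` by deleting the vertices in `S`. -/
abbrev deleteSet (G : SimpleGraph V) (S : Set V) : SimpleGraph (Sᶜ : Set V) :=
  G.induce Sᶜ

/-- `d_S(u)`: the number of neighbours of `u` in `S`, for a finite graph. -/
noncomputable def degreeIn (G : SimpleGraph V) (S : Set V) (u : V) : ℕ :=
  (G.neighborSet u ∩ S).ncard

end SimpleGraph

/-! Suppose no such vertex exists. It suffices that every component `H` of `G - C` meets at most `(c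
/ 2 - 1) * |H|` edges: summing over components contradicts the edge hypothesis. Call the vertices of
`C` with a neighbour in `H` its feet. As `C` is longest, a path through `H` with `l` inner vertices
between two feet (an ear) forces both arcs between them to have length at least `l + 1`. So feet are
never consecutive and there are at most `c / 2` of them; equality is impossible when `|H| ≥ 2`
(`card_feet_le`) and excluded by assumption when `|H| = 1`.

The bound follows by induction on `|H|` (`attachedWeight_le`). Contracting an edge `xy` of `H` loses
one edge, plus one for each common neighbour of `x` and `y`. An edge with fewer than `c / 2 - 1`
common neighbours can therefore be contracted, provided `{x, y}` cuts no part of `H` off from the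
cycle. Contraction creates neither longer ears nor new feet; `IsAttached` records exactly the
properties that survive it.

If no such edge remains, every edge turns out to have at least `c / 2 - 1` common neighbours: a
vertex cut off by a separating pair would have only such edges, and hence neighbours on the cycle
(`forall_escapes`). Then a longest cycle of `H`, a single edge being allowed as one, has `c / 2 - 1`
vertices and exhausts `H`, and each vertex has at most two neighbours on `C`
(`attachedWeight_le_of_thick`). The bound is then immediate. -/

/-- A walk to a vertex satisfying `P` contains a path that stops at its first `P`-vertex. -/
theorem Relation.ReflTransGen.exists_isChain_nodup {α : Type*} {R : α → α → Prop} {P Q : α → Prop}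
    {v t : α} (h : Relation.ReflTransGen R v t) (hP : P t) (hQ : ∀ a b, R a b → Q b) (hv : Q v) :
    ∃ (q : List α) (x : α), (q ++ [x]).head? = some v ∧ (q ++ [x]).IsChain R ∧ (q ++ [x]).Nodup ∧
      P x ∧ (∀ a ∈ q, ¬ P a) ∧ ∀ a ∈ q ++ [x], Q a := by
  induction h using Relation.ReflTransGen.head_induction_on with
  | refl => exact ⟨[], t, by simp, by simp, by simp, hP, by simp, by simpa using hv⟩
  | @head v v' hvv' _ ih =>
    by_cases hPv : P v
    · exact ⟨[], v, by simp, by simp, by simp, hPv, by simp, by simpa using hv⟩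
    obtain ⟨q, x, h1, h2, h3, h4, h5, h6⟩ := ih (hQ _ _ hvv')
    by_cases hm : v ∈ q
    · obtain ⟨q1, q2, rfl⟩ := List.append_of_mem hm
      refine ⟨v :: q2, x, by simp, ?_, ?_, h4, fun a ha => h5 a (by simp_all),
        fun a ha => h6 a (by simp_all)⟩
      · rw [List.append_assoc] at h2
        exact h2.right_of_append
      · rw [List.append_assoc] at h3
        exact (List.nodup_append.1 h3).2.1
    · have hvx : v ≠ x := by rintro rfl; exact hPv h4
      refine ⟨v :: q, x, by simp, ?_, ?_, h4, ?_, ?_⟩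
      · rw [List.cons_append, List.isChain_cons]
        refine ⟨fun y hy => ?_, h2⟩
        rw [h1] at hy
        simp at hy
        exact hy ▸ hvv'
      · rw [List.cons_append, List.nodup_cons]
        exact ⟨by simp [hm, hvx], h3⟩
      · simpa [hPv] using h5
      · simp only [List.cons_append, List.mem_cons, forall_eq_or_imp]
        exact ⟨hv, h6⟩

namespace SimpleGraph

/-! ### Ears: paths through `H` with both ends on the cycle -/

section Ears

variable {V : Type*} {G : SimpleGraph V} {c : ℕ} {φ : ZMod c → V} {H : Finset V}

/-- `l` is the list of inner vertices of a path from `φ i` to `φ j` through `H`. -/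
structure IsEar (G : SimpleGraph V) (φ : ZMod c → V) (H : Finset V) (i j : ZMod c) (l : List V) :
    Prop where
  ne : i ≠ j
  ne_nil : l ≠ []
  mem : ∀ v ∈ l, v ∈ H
  nodup : l.Nodup
  chain : (φ i :: (l ++ [φ j])).IsChain G.Adj

/-- Some walk in `H \ S` leads from `v` to a vertex with a neighbour `φ i ∉ S`. -/
def Escapes (G : SimpleGraph V) (φ : ZMod c → V) (H : Finset V) (S : Set V) (v : V) : Prop :=
  ∃ t i, Relation.ReflTransGen (fun a b => G.Adj a b ∧ b ∈ H ∧ b ∉ S) v t ∧ G.Adj t (φ i) ∧ φ i ∉ S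

/-- `H` is a connected set of vertices off the cycle `φ`, attached to it in a 2-connected way,
and no path through `H` can be used to make the cycle longer. -/
structure IsAttached (G : SimpleGraph V) (φ : ZMod c → V) (H : Finset V) : Prop where
  notMem : ∀ i, φ i ∉ H
  connected : ∀ u ∈ H, ∀ w ∈ H, Relation.ReflTransGen (fun a b => G.Adj a b ∧ b ∈ H) u w
  escapes : ∀ z v, z ∈ H ∨ z ∈ Set.range φ → v ∈ H → v ≠ z → Escapes G φ H {z} v
  length_ear : ∀ i j l, IsEar G φ H i j l → l.length + 1 ≤ (j - i).val

theorem isChain_adj_reverse {l : List V} (h : l.IsChain G.Adj) : l.reverse.IsChain G.Adj := by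
  rw [List.isChain_reverse]
  exact h.imp fun _ _ h => h.symm

theorem IsEar.reverse {i j : ZMod c} {l : List V} (h : IsEar G φ H i j l) :
    IsEar G φ H j i l.reverse where
  ne := h.ne.symm
  ne_nil := by simpa using h.ne_nil
  mem := by simpa using h.mem
  nodup := by simpa using h.nodup
  chain := by simpa using isChain_adj_reverse h.chain

theorem isEar_of_isChain {i j : ZMod c} {l : List V} {x y : V} (hij : i ≠ j) (hl : l.IsChain G.Adj)
    (hn : l.Nodup) (hm : ∀ v ∈ l, v ∈ H) (hx : l.head? = some x) (hy : l.getLast? = some y)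
    (hi : G.Adj x (φ i)) (hj : G.Adj y (φ j)) : IsEar G φ H i j l where
  ne := hij
  ne_nil := by rintro rfl; simp at hx
  mem := hm
  nodup := hn
  chain := by
    rw [List.isChain_cons]
    constructor
    · intro z hz
      rw [List.head?_append, hx] at hz
      simp at hz
      exact hz ▸ hi.symm
    · rw [List.isChain_append]
      refine ⟨hl, by simp, fun a ha b hb => ?_⟩
      rw [hy] at ha
      simp at ha hb
      exact ha ▸ hb ▸ hj

/-- Read in both directions, the ear bounds both arcs between its ends from below, and the arcs have
total length `c`. -/
theorem IsEar.two_mul_length_le [NeZero c] (hH : IsAttached G φ H) {i j : ZMod c} {l : List V}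
    (h : IsEar G φ H i j l) : 2 * (l.length + 1) ≤ c := by
  have h1 := hH.length_ear i j l h
  have h2 := hH.length_ear j i _ h.reverse
  rw [List.length_reverse] at h2
  have h3 : (i - j).val = c - (j - i).val := by
    rw [← neg_sub j i]
    have : NeZero (j - i) := ⟨sub_ne_zero.2 h.ne.symm⟩
    exact ZMod.val_neg_of_ne_zero _
  have := (j - i).val_lt
  omega

theorem IsEar.length_lt [NeZero c] (hH : IsAttached G φ H) {i j : ZMod c} {l : List V}
    (h : IsEar G φ H i j l) : l.length < c / 2 := by
  have := h.two_mul_length_le hH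
  omega

/-- Insert a vertex of `H` into an edge of an ear. -/
theorem IsEar.insert {i j : ZMod c} {l₁ l₂ : List V} {x y t : V}
    (h : IsEar G φ H i j (l₁ ++ x :: y :: l₂)) (ht : t ∈ H) (htl : t ∉ l₁ ++ x :: y :: l₂)
    (hx : G.Adj x t) (hy : G.Adj y t) : IsEar G φ H i j (l₁ ++ x :: t :: y :: l₂) where
  ne := h.ne
  ne_nil := by simp
  mem := by
    have := h.mem
    simp at this ⊢
    grind
  nodup := by
    have := h.nodup
    have h2 : (l₁ ++ x :: t :: y :: l₂).Perm (t :: (l₁ ++ x :: y :: l₂)) := by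
      have := List.perm_middle (a := t) (l₁ := l₁ ++ [x]) (l₂ := y :: l₂)
      simpa using this
    rw [h2.nodup_iff, List.nodup_cons]
    exact ⟨htl, this⟩
  chain := by
    have := h.chain
    simp only [List.append_assoc, List.cons_append] at this ⊢
    rw [List.isChain_cons_append_cons_cons] at this ⊢
    rw [List.isChain_cons_cons]
    exact ⟨this.1, hx, hy.symm, this.2.2⟩

/-- The detour leaves the ear at `r` and rejoins it at `x` further on; the stretch of `l₂` before
`x` is discarded, so no vertex repeats. -/
theorem IsEar.detour {i j : ZMod c} {l₁ l₂ N q : List V} {r x : V}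
    (h : IsEar G φ H i j (l₁ ++ r :: l₂)) (hq : (r :: (q ++ [x])).IsChain G.Adj)
    (hqn : (q ++ [x]).Nodup) (hqH : ∀ a ∈ q ++ [x], a ∈ H) (hql : ∀ a ∈ q, a ∉ l₁ ++ r :: l₂)
    (hN : x :: N <:+ l₂) : IsEar G φ H i j (l₁ ++ r :: (q ++ x :: N)) := by
  obtain ⟨M, rfl⟩ := hN
  refine ⟨h.ne, by simp, ?_, ?_, ?_⟩
  · have := h.mem
    simp at this hqH ⊢
    grind
  · have := h.nodup
    simp [List.nodup_append, List.nodup_cons] at this hqn hql ⊢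
    grind
  · have := h.chain
    simp only [List.append_assoc, List.cons_append] at this ⊢
    rw [← List.cons_append, List.isChain_split] at this ⊢
    refine ⟨this.1, ?_⟩
    have h2 := this.2
    rw [← List.cons_append, List.isChain_split] at h2 ⊢
    exact ⟨hq, h2.2⟩

/-- Here the new path runs to the cycle without returning to the ear, so all of `l₂` is discarded.
-/
theorem IsEar.branch {i j m : ZMod c} {l₁ l₂ q : List V} {r x : V}
    (h : IsEar G φ H i j (l₁ ++ r :: l₂)) (hq : (r :: (q ++ [x])).IsChain G.Adj)
    (hqn : (q ++ [x]).Nodup) (hqH : ∀ a ∈ q ++ [x], a ∈ H) (hql : ∀ a ∈ q ++ [x], a ∉ l₁ ++ r :: l₂)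
    (him : i ≠ m) (hm : G.Adj x (φ m)) : IsEar G φ H i m (l₁ ++ r :: (q ++ [x])) := by
  refine ⟨him, by simp, ?_, ?_, ?_⟩
  · have := h.mem
    simp at this hqH ⊢
    grind
  · have := h.nodup
    simp [List.nodup_append, List.nodup_cons] at this hqn hql ⊢
    grind
  · have := h.chain
    simp only [List.append_assoc, List.cons_append] at this ⊢
    rw [← List.cons_append, List.isChain_split] at this ⊢
    refine ⟨this.1, ?_⟩
    have : (r :: q ++ x :: [φ m]).IsChain G.Adj := List.isChain_split.2 ⟨hq, by simpa using hm⟩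
    simpa using this

theorem IsEar.exists_through_aux {i j : ZMod c} {l₁ l₂ q : List V} {r r' x : V}
    (h : IsEar G φ H i j (l₁ ++ r :: l₂)) (hq : (r :: (q ++ [x])).IsChain G.Adj)
    (hqn : (q ++ [x]).Nodup) (hqH : ∀ a ∈ q ++ [x], a ∈ H) (hql : ∀ a ∈ q, a ∉ l₁ ++ r :: l₂)
    (hr' : (q ++ [x]).head? = some r')
    (hx : x ∈ l₂ ∨ x ∉ l₁ ++ r :: l₂ ∧ ∃ m, i ≠ m ∧ G.Adj x (φ m)) :
    ∃ i j l₁ l₂, IsEar G φ H i j (l₁ ++ r :: r' :: l₂) := by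
  obtain ⟨p, hp⟩ : ∃ p, q ++ [x] = r' :: p := by
    cases hqx : q ++ [x] with
    | nil => simp at hqx
    | cons a p => rw [hqx] at hr'; simp at hr'; exact ⟨p, by rw [hr']⟩
  rcases hx with hx | ⟨hx, m, him, hm⟩
  · obtain ⟨M, N, rfl⟩ := List.append_of_mem hx
    have := h.detour hq hqn hqH hql (N := N) ⟨M, rfl⟩
    refine ⟨i, j, l₁, p ++ N, ?_⟩
    rw [← List.cons_append, ← hp]
    simpa using this
  · have := h.branch hq hqn hqH (by
      intro a ha
      rw [List.mem_append, List.mem_singleton] at ha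
      rcases ha with ha | rfl
      exacts [hql a ha, hx]) him hm
    exact ⟨i, m, l₁, p, by rwa [hp] at this⟩

/-- If an ear passes through `r`, then every edge `rr'` in `H` lies on an ear. -/
theorem IsAttached.exists_ear_step (hH : IsAttached G φ H) {i j : ZMod c} {l : List V} {r r' : V}
    (h : IsEar G φ H i j l) (hr : r ∈ l) (hr' : r' ∈ H) (hrr' : G.Adj r r') :
    ∃ i j l₁ l₂, IsEar G φ H i j (l₁ ++ r :: r' :: l₂) := by
  obtain ⟨t, m, htr, htm, -⟩ := hH.escapes r r' (Or.inl (h.mem r hr)) hr' hrr'.ne'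
  -- Walk on from `r'`, avoiding `r`, and stop at the first vertex that lies on the ear or has a
  -- neighbour on the cycle.
  obtain ⟨q, x, h1, h2, h3, h4, h5, h6⟩ := htr.exists_isChain_nodup
    (P := fun a => a ∈ l ∨ ∃ m, G.Adj a (φ m)) (Q := fun b => b ∈ H ∧ b ≠ r) (Or.inr ⟨m, htm⟩)
    (fun a b hab => by simpa using hab.2) ⟨hr', hrr'.ne'⟩
  have hq : (r :: (q ++ [x])).IsChain G.Adj := by
    rw [List.isChain_cons]
    refine ⟨fun y hy => ?_, h2.imp fun _ _ h => h.1⟩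
    rw [h1] at hy
    simp at hy
    exact hy ▸ hrr'
  obtain ⟨l₁, l₂, rfl⟩ := List.append_of_mem hr
  have hql : ∀ a ∈ q, a ∉ l₁ ++ r :: l₂ := fun a ha hal => h5 a ha (Or.inl hal)
  have hxr : x ≠ r := (h6 x (by simp)).2
  have hqH : ∀ a ∈ q ++ [x], a ∈ H := fun a ha => (h6 a ha).1
  have hrev := h.reverse
  simp only [List.reverse_append, List.reverse_cons, List.append_assoc, List.singleton_append]
    at hrev
  have hmem : ∀ a, a ∈ l₂.reverse ++ r :: l₁.reverse ↔ a ∈ l₁ ++ r :: l₂ := by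
    intro a; simp; tauto
  by_cases hxl : x ∈ l₁ ++ r :: l₂
  · have : x ∈ l₁ ∨ x ∈ l₂ := by simpa [hxr] using hxl
    rcases this with hx | hx
    · exact hrev.exists_through_aux hq h3 hqH (fun a ha => by rw [hmem]; exact hql a ha) h1
        (Or.inl (by simpa using hx))
    · exact h.exists_through_aux hq h3 hqH hql h1 (Or.inl hx)
  · obtain ⟨m, hm⟩ := h4.resolve_left hxl
    -- If the new foot is `i` itself, keep the half of the ear that ends at `j` instead.
    by_cases him : i = m
    · exact hrev.exists_through_aux hq h3 hqH (fun a ha => by rw [hmem]; exact hql a ha) h1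
        (Or.inr ⟨by rwa [hmem], m, him ▸ h.ne.symm, hm⟩)
    · exact h.exists_through_aux hq h3 hqH hql h1 (Or.inr ⟨hxl, m, him, hm⟩)

/-- A path in `H` between two vertices attached to different vertices of the cycle is an ear. -/
theorem IsAttached.exists_ear_of_adj (hH : IsAttached G φ H) {i j : ZMod c} {u w : V} (hij : i ≠ j)
    (hu : u ∈ H) (hw : w ∈ H) (hi : G.Adj u (φ i)) (hj : G.Adj w (φ j)) :
    ∃ l, IsEar G φ H i j l ∧ u ∈ l ∧ w ∈ l := by
  obtain ⟨q, x, h1, h2, h3, rfl, -, h6⟩ := (hH.connected u hu w hw).exists_isChain_nodup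
    (P := fun a => a = w) (Q := fun b => b ∈ H) rfl (fun a b hab => hab.2) hu
  exact ⟨q ++ [x], isEar_of_isChain hij (h2.imp fun _ _ h => h.1) h3 h6 h1 (by simp) hi hj,
    List.mem_of_mem_head? h1, by simp⟩

/-- Every edge of `H` lies on an ear. -/
theorem IsAttached.exists_ear_through (hH : IsAttached G φ H) [NeZero c] {r r' : V} (hr : r ∈ H)
    (hr' : r' ∈ H) (hrr' : G.Adj r r') : ∃ i j l₁ l₂, IsEar G φ H i j (l₁ ++ r :: r' :: l₂) := by
  suffices ∃ i j l, IsEar G φ H i j l ∧ r ∈ l by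
    obtain ⟨i, j, l, hl, hrl⟩ := this
    exact hH.exists_ear_step hl hrl hr' hrr'
  have key : ∀ z ∈ Set.range φ, ∃ t ∈ H, ∃ i, G.Adj t (φ i) ∧ φ i ≠ z := by
    intro z hz
    obtain ⟨t, i, h, hi, hiz⟩ := hH.escapes z r (Or.inr hz) hr
      (by rintro rfl; obtain ⟨i, rfl⟩ := hz; exact hH.notMem i hr)
    refine ⟨t, ?_, i, hi, hiz⟩
    rcases Relation.ReflTransGen.cases_tail h with h | ⟨_, -, h⟩
    exacts [h ▸ hr, h.2.1]
  obtain ⟨u, hu, i, hi, -⟩ := key (φ 0) ⟨_, rfl⟩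
  obtain ⟨w, hw, j, hj, hij⟩ := key (φ i) ⟨_, rfl⟩
  obtain ⟨l, hl, hul, -⟩ := hH.exists_ear_of_adj (i := i) (j := j) (by rintro rfl; exact hij rfl)
    hu hw hi hj
  have hur := hH.connected u hu r hr
  clear hr hr' hrr'
  induction hur with
  | refl => exact ⟨i, j, l, hl, hul⟩
  | tail _ hbc ih =>
    obtain ⟨i, j, l, hl, hbl⟩ := ih
    obtain ⟨i, j, l₁, l₂, h⟩ := hH.exists_ear_step hl hbl hbc.2 hbc.1
    exact ⟨i, j, _, h, by simp⟩

end Ears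

/-! ### Contracting an edge of `H` -/

section Contraction

variable {V : Type*} {G : SimpleGraph V} {c : ℕ} {φ : ZMod c → V} {H : Finset V} {x y : V}

/-- Contract `y` into `x`; the vertex `y` itself is kept, as it is to be ignored afterwards. -/
def contractInto (G : SimpleGraph V) (x y : V) : SimpleGraph V where
  Adj a b := a ≠ b ∧ (G.Adj a b ∨ a = x ∧ G.Adj y b ∨ b = x ∧ G.Adj a y)
  symm := ⟨fun a b h => ⟨h.1.symm, by
    rcases h.2 with h | ⟨h1, h2⟩ | ⟨h1, h2⟩
    exacts [Or.inl h.symm, Or.inr (Or.inr ⟨h1, h2.symm⟩), Or.inr (Or.inl ⟨h1, h2.symm⟩)]⟩⟩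
  loopless := ⟨fun _ h => h.1 rfl⟩

theorem le_contractInto : G ≤ G.contractInto x y := fun _ _ h => ⟨h.ne, Or.inl h⟩

theorem contractInto_adj_iff_of_ne {a b : V} (ha : a ≠ x) (hb : b ≠ x) :
    (G.contractInto x y).Adj a b ↔ G.Adj a b := by
  simp only [contractInto, ha, hb, false_and, or_false]
  exact ⟨fun h => h.2, fun h => ⟨h.ne, h⟩⟩

theorem contractInto_adj_left_iff {b : V} (hb : b ≠ x) :
    (G.contractInto x y).Adj x b ↔ G.Adj x b ∨ G.Adj y b := by
  simp [contractInto, hb, hb.symm]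

theorem adj_contractInto_right_iff {a : V} (ha : a ≠ x) :
    (G.contractInto x y).Adj a x ↔ G.Adj a x ∨ G.Adj a y := by
  simp [contractInto, ha]

open scoped Classical in
theorem reflTransGen_contractInto {S : Set V} {a b : V} (hx : x ∈ H) (hxS : x ∉ S) (hxy : x ≠ y)
    (h : Relation.ReflTransGen (fun a b => G.Adj a b ∧ b ∈ H ∧ b ∉ S) a b) :
    Relation.ReflTransGen (fun a b => (G.contractInto x y).Adj a b ∧ b ∈ H.erase y ∧ b ∉ S)
      (if a = y then x else a) (if b = y then x else b) := by
  induction h with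
  | refl => rfl
  | @tail b d _ hbd ih =>
    by_cases heq : (if b = y then x else b) = (if d = y then x else d)
    · rwa [← heq]
    · refine ih.tail ⟨?_, ?_⟩
      · have hbd1 := hbd.1
        refine ⟨heq, ?_⟩
        by_cases hb : b = y <;> by_cases hd : d = y
        · exact absurd (by rw [hb, hd]) heq
        · subst hb; simp [hd, hbd1]
        · subst hd; simp [hb, hbd1]
        · simp [hb, hd, hbd1]
      · by_cases hd : d = y
        · simp [hd, hx, hxS, hxy]
        · simp [hd, hbd.2.1, hbd.2.2]

-- The neighbours `p`, `q` of the merged vertex on the ear are each adjacent in `G` to `x` or `y`,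
-- so the merged vertex can be replaced by one of `x`, `y`, `xy`, `yx`.
open scoped Classical in
theorem IsEar.exists_of_contractInto (hφ : ∀ i, φ i ∉ H) (hx : x ∈ H) (hy : y ∈ H) (hxy : G.Adj x y)
    {i j : ZMod c} {l : List V} (h : IsEar (G.contractInto x y) φ (H.erase y) i j l) :
    ∃ l', IsEar G φ H i j l' ∧ l.length ≤ l'.length := by
  have hφx : ∀ i, φ i ≠ x := fun i hi => hφ i (hi ▸ hx)
  have hmem : ∀ v ∈ l, v ∈ H := fun v hv => Finset.mem_of_mem_erase (h.mem v hv)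
  have hyl : y ∉ l := fun hyl => by simpa using h.mem y hyl
  by_cases hxl : x ∈ l
  · obtain ⟨l₁, l₂, rfl⟩ := List.append_of_mem hxl
    have hn := h.nodup
    have hx1 : x ∉ l₁ := fun hx => by
      simp [List.nodup_append] at hn
      exact (hn.2.2 x hx).1 rfl
    have hx2 : x ∉ l₂ := fun hx => by simp [List.nodup_append, hx] at hn
    have hch := h.chain
    rw [List.append_assoc, List.cons_append, ← List.cons_append, List.isChain_split] at hch
    obtain ⟨p, l₁', hp⟩ : ∃ p l₁', φ i :: l₁ = l₁' ++ [p] :=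
      ⟨_, _, (List.dropLast_append_getLast (List.cons_ne_nil _ _)).symm⟩
    obtain ⟨q, l₂', hq⟩ : ∃ q l₂', l₂ ++ [φ j] = q :: l₂' := by
      cases l₂ with
      | nil => exact ⟨_, _, rfl⟩
      | cons a t => exact ⟨a, t ++ [φ j], rfl⟩
    rw [hp, hq] at hch
    have hp' : ∀ a ∈ l₁' ++ [p], a ≠ x := by
      rw [← hp]
      rintro a ha rfl
      simp [hx1, (hφx i).symm] at ha
    have hq' : ∀ a ∈ q :: l₂', a ≠ x := by
      rw [← hq]
      rintro a ha rfl
      simp [hx2, (hφx j).symm] at ha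
    have hL : (l₁' ++ [p]).IsChain G.Adj := by
      have := hch.1.left_of_append
      exact List.IsChain.imp_of_mem_imp (fun a b ha hb hab =>
        (contractInto_adj_iff_of_ne (hp' a ha) (hp' b hb)).1 hab) this
    have hR : (q :: l₂').IsChain G.Adj := by
      have := hch.2.tail
      exact List.IsChain.imp_of_mem_imp (fun a b ha hb hab =>
        (contractInto_adj_iff_of_ne (hq' a ha) (hq' b hb)).1 hab) this
    have hpx : G.Adj p x ∨ G.Adj p y := by
      have := hch.1
      rw [List.append_assoc, List.singleton_append, List.isChain_append_cons_cons] at this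
      exact (adj_contractInto_right_iff (hp' p (by simp))).1 this.2.1
    have hxq : G.Adj x q ∨ G.Adj y q :=
      (contractInto_adj_left_iff (hq' q (by simp))).1 (List.isChain_cons_cons.1 hch.2).1
    have key : ∀ m : List V, m ≠ [] → (∀ a ∈ m, a = x ∨ a = y) → m.Nodup →
        ((l₁' ++ [p]) ++ m ++ (q :: l₂')).IsChain G.Adj →
        ∃ l', IsEar G φ H i j l' ∧ (l₁ ++ x :: l₂).length ≤ l'.length := by
      intro m hm hmx hmn hmc
      refine ⟨l₁ ++ m ++ l₂, ⟨h.ne, by simp [hm], ?_, ?_, ?_⟩, ?_⟩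
      · simp only [List.mem_append]
        rintro v ((hv | hv) | hv)
        · exact hmem v (by simp [hv])
        · rcases hmx v hv with rfl | rfl <;> assumption
        · exact hmem v (by simp [hv])
      · simp [List.nodup_append] at hn hyl ⊢
        grind
      · rw [← hp, ← hq] at hmc
        simpa using hmc
      · have := List.length_pos_iff.2 hm
        simp
        omega
    have hj : ∀ a b, G.Adj p a → G.Adj b q → ∀ m : List V, (a :: m).IsChain G.Adj →
        (a :: m).getLast? = some b → ((l₁' ++ [p]) ++ (a :: m) ++ (q :: l₂')).IsChain G.Adj := by
      intro a b hpa hbq m hmc hmb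
      rw [List.isChain_append]
      refine ⟨?_, hR, ?_⟩
      · rw [List.append_assoc, List.singleton_append, List.isChain_append_cons_cons]
        exact ⟨hL, hpa, hmc⟩
      · intro u hu v hv
        rw [List.getLast?_append, hmb] at hu
        simp at hu hv
        exact hu ▸ hv ▸ hbq
    rcases hpx with hpx | hpy <;> rcases hxq with hxq | hyq
    · exact key [x] (by simp) (by simp) (by simp) (hj x x hpx hxq [] (by simp) (by simp))
    · exact key [x, y] (by simp) (by simp) (by simp [hxy.ne])
        (hj x y hpx hyq [y] (by simp [hxy]) (by simp))
    · exact key [y, x] (by simp) (by simp) (by simp [hxy.ne'])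
        (hj y x hpy hxq [x] (by simp [hxy.symm]) (by simp))
    · exact key [y] (by simp) (by simp) (by simp) (hj y y hpy hyq [] (by simp) (by simp))
  · refine ⟨l, ⟨h.ne, h.ne_nil, hmem, h.nodup, ?_⟩, le_rfl⟩
    have : ∀ a ∈ φ i :: (l ++ [φ j]), a ≠ x := by
      rintro a ha rfl
      simp [hxl, (hφx _).symm] at ha
    exact List.IsChain.imp_of_mem_imp (fun a b ha hb hab =>
      (contractInto_adj_iff_of_ne (this a ha) (this b hb)).1 hab) h.chain

open scoped Classical in
/-- Contracting an edge of `H` whose ends do not separate a part of `H` from the cycle. -/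
theorem IsAttached.contractInto (hH : IsAttached G φ H) (hx : x ∈ H) (hy : y ∈ H)
    (hxy : G.Adj x y) (hgood : ∀ s ∈ H, s ≠ x → s ≠ y → Escapes G φ H {x, y} s) :
    IsAttached (G.contractInto x y) φ (H.erase y) where
  notMem i hi := hH.notMem i (Finset.mem_of_mem_erase hi)
  connected u hu w hw := by
    have h := hH.connected u (Finset.mem_of_mem_erase hu) w (Finset.mem_of_mem_erase hw)
    have := reflTransGen_contractInto (G := G) (S := ∅) hx (by simp) hxy.ne
      (Relation.ReflTransGen.mono (fun a b hab => ⟨hab.1, hab.2, by simp⟩) _ _ h)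
    rw [if_neg (Finset.ne_of_mem_erase hu), if_neg (Finset.ne_of_mem_erase hw)] at this
    exact Relation.ReflTransGen.mono (fun a b hab => ⟨hab.1, hab.2.1⟩) _ _ this
  escapes z v hz hv hvz := by
    have hφx : ∀ i, φ i ≠ x := fun i hi => hH.notMem i (hi ▸ hx)
    have hφy : ∀ i, φ i ≠ y := fun i hi => hH.notMem i (hi ▸ hy)
    have hvy := Finset.ne_of_mem_erase hv
    -- Deleting the merged vertex amounts to deleting both `x` and `y`, which is where `hgood`
    -- enters.
    by_cases hzx : z = x
    · subst hzx
      obtain ⟨t, i, h, hi, -⟩ := hgood v (Finset.mem_of_mem_erase hv) hvz hvy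
      refine ⟨t, i, Relation.ReflTransGen.mono (fun a b hab => ?_) _ _ h, le_contractInto hi, by simpa using hφx i⟩
      have h2 := hab.2.2
      simp only [Set.mem_insert_iff, Set.mem_singleton_iff, not_or] at h2
      exact ⟨le_contractInto hab.1, Finset.mem_erase.2 ⟨h2.2, hab.2.1⟩, by simpa using h2.1⟩
    · obtain ⟨t, i, h, hi, hiz⟩ := hH.escapes z v (hz.imp_left Finset.mem_of_mem_erase)
        (Finset.mem_of_mem_erase hv) hvz
      have h' := reflTransGen_contractInto hx (by simpa using Ne.symm hzx) hxy.ne h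
      rw [if_neg hvy] at h'
      refine ⟨_, i, h', ?_, hiz⟩
      by_cases ht : t = y
      · rw [if_pos ht, contractInto_adj_left_iff (hφx i)]
        exact Or.inr (ht ▸ hi)
      · rw [if_neg ht]
        exact le_contractInto hi
  length_ear i j l hl := by
    obtain ⟨l', hl', hle⟩ := hl.exists_of_contractInto hH.notMem hx hy hxy
    have := hH.length_ear i j l' hl'
    omega

end Contraction

/-! ### Counting the edges that meet `H` -/

section Weight

open scoped Classical

variable {V : Type*} {G : SimpleGraph V} {c : ℕ} [NeZero c] {φ : ZMod c → V} {H : Finset V} {x y : V}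

/-- The indices of the neighbours of `v` on the cycle `φ`. -/
noncomputable def cycleNbrs (G : SimpleGraph V) (φ : ZMod c → V) (v : V) : Finset (ZMod c) :=
  Finset.univ.filter fun i => G.Adj v (φ i)

@[simp] theorem mem_cycleNbrs {v : V} {i : ZMod c} : i ∈ cycleNbrs G φ v ↔ G.Adj v (φ i) := by
  simp [cycleNbrs]

/-- Twice the number of edges that meet `H`. -/
noncomputable def attachedWeight (G : SimpleGraph V) (φ : ZMod c → V) (H : Finset V) : ℕ :=
  ∑ v ∈ H, ((H.filter (G.Adj v)).card + 2 * (cycleNbrs G φ v).card)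

/-- The number of common neighbours of `x` and `y` in `H` and on the cycle. -/
noncomputable def commonCard (G : SimpleGraph V) (φ : ZMod c → V) (H : Finset V) (x y : V) : ℕ :=
  (H.filter fun w => G.Adj x w ∧ G.Adj y w).card + (cycleNbrs G φ x ∩ cycleNbrs G φ y).card

/-- The indices of the vertices of the cycle with a neighbour in `H`. -/
noncomputable def feet (G : SimpleGraph V) (φ : ZMod c → V) (H : Finset V) : Finset (ZMod c) :=
  H.biUnion (cycleNbrs G φ)

theorem feet_contractInto_subset (hφ : ∀ i, φ i ∉ H) (hx : x ∈ H) (hy : y ∈ H) :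
    feet (G.contractInto x y) φ (H.erase y) ⊆ feet G φ H := by
  intro i hi
  simp only [feet, Finset.mem_biUnion, Finset.mem_erase, mem_cycleNbrs] at hi ⊢
  obtain ⟨t, ⟨hty, ht⟩, hi⟩ := hi
  have hφx : φ i ≠ x := fun h => hφ i (h ▸ hx)
  by_cases htx : t = x
  · subst htx
    rw [contractInto_adj_left_iff hφx] at hi
    rcases hi with hi | hi
    exacts [⟨t, ht, hi⟩, ⟨y, hy, hi⟩]
  · rw [contractInto_adj_iff_of_ne htx hφx] at hi
    exact ⟨t, ht, hi⟩

/-- The edge `xy` disappears and, at each common neighbour, two edges merge into one; the weight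
counts every edge twice. -/
theorem attachedWeight_contractInto (hφ : ∀ i, φ i ∉ H) (hx : x ∈ H) (hy : y ∈ H)
    (hxy : G.Adj x y) : attachedWeight G φ H =
      attachedWeight (G.contractInto x y) φ (H.erase y) + 2 * (commonCard G φ H x y + 1) := by
  obtain ⟨K, hxK, hyK, rfl⟩ : ∃ K : Finset V, x ∉ K ∧ y ∉ insert x K ∧ H = insert y (insert x K) :=
    ⟨(H.erase y).erase x, by simp, by simp [hxy.ne'], by
      rw [Finset.insert_erase (Finset.mem_erase.2 ⟨hxy.ne, hx⟩), Finset.insert_erase hy]⟩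
  have hφx : ∀ i, φ i ≠ x := fun i hi => hφ i (hi ▸ hx)
  rw [Finset.erase_insert hyK]
  set G' := G.contractInto x y with hG'
  have hKx : ∀ w ∈ K, w ≠ x := fun w hw h => hxK (h ▸ hw)
  have e1 : ∀ v ∈ K, (K.filter (G'.Adj v)).card = (K.filter (G.Adj v)).card := fun v hv => by
    congr 1
    exact Finset.filter_congr fun w hw => contractInto_adj_iff_of_ne (hKx v hv) (hKx w hw)
  have e2 : ∀ v ∈ K, (cycleNbrs G' φ v).card = (cycleNbrs G φ v).card := fun v hv => by
    congr 1
    ext i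
    simp [hG', contractInto_adj_iff_of_ne (hKx v hv) (hφx i)]
  have e3 : (K.filter (G'.Adj x)).card + (K.filter fun w => G.Adj x w ∧ G.Adj y w).card =
      (K.filter (G.Adj x)).card + (K.filter (G.Adj y)).card := by
    rw [← Finset.card_union_add_card_inter (K.filter (G.Adj x)), ← Finset.filter_or,
      ← Finset.filter_and]
    congr 2
    exact Finset.filter_congr fun w hw => contractInto_adj_left_iff (hKx w hw)
  have e4 : (cycleNbrs G' φ x).card + (cycleNbrs G φ x ∩ cycleNbrs G φ y).card =
      (cycleNbrs G φ x).card + (cycleNbrs G φ y).card := by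
    rw [← Finset.card_union_add_card_inter (cycleNbrs G φ x)]
    congr 2
    ext i
    simp [hG', contractInto_adj_left_iff (hφx i)]
  have hins : ∀ (F : SimpleGraph V) (v a : V) (A : Finset V), a ∉ A →
      ((insert a A).filter (F.Adj v)).card = (A.filter (F.Adj v)).card + if F.Adj v a then 1 else 0 := by
    intro F v a A ha
    rw [Finset.filter_insert]
    split_ifs
    · rw [Finset.card_insert_of_notMem (by simp [ha])]
    · rfl
  have hsum : ∀ (F : SimpleGraph V) (a : V),
      ∑ v ∈ K, (if F.Adj v a then 1 else 0) = (K.filter (F.Adj a)).card := by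
    intro F a
    rw [Finset.card_filter]
    exact Finset.sum_congr rfl fun v _ => by simp [F.adj_comm]
  have hcom : ((insert y (insert x K)).filter fun w => G.Adj x w ∧ G.Adj y w) =
      K.filter fun w => G.Adj x w ∧ G.Adj y w := by
    rw [Finset.filter_insert, Finset.filter_insert]
    simp
  unfold attachedWeight commonCard
  rw [hcom, Finset.sum_insert hyK, Finset.sum_insert hxK, Finset.sum_insert hxK]
  simp only [hins _ _ _ _ hyK, hins _ _ _ _ hxK, Finset.sum_add_distrib, hsum,
    Finset.sum_congr rfl e1, ← Finset.mul_sum, Finset.sum_congr rfl e2, SimpleGraph.irrefl, hxy,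
    hxy.symm, if_true, if_false]
  omega

end Weight

end SimpleGraph

theorem Nat.exists_maximal_of_bounded {P : ℕ → Prop} {b : ℕ} (hb : ∀ n, P n → n ≤ b)
    (h : ∃ n, P n) : ∃ n, P n ∧ ∀ m, P m → m ≤ n := by
  classical
  obtain ⟨n, hn⟩ := h
  exact ⟨Nat.findGreatest P b, Nat.findGreatest_spec (hb n hn) hn,
    fun m hm => Nat.le_findGreatest (hb m hm) hm⟩

/-- Elements of `ZMod c` at cyclic distance at least `g` from each other. -/
theorem ZMod.card_mul_le_of_forall_le_val_sub {c : ℕ} [NeZero c] {J : Finset (ZMod c)} {g : ℕ}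
    (hJ : 2 ≤ J.card) (h : ∀ i ∈ J, ∀ j ∈ J, i ≠ j → g ≤ (j - i).val) : J.card * g ≤ c := by
  have hgc : g ≤ c := by
    obtain ⟨i, hi, j, hj, hij⟩ := Finset.one_lt_card.1 (show 1 < J.card by omega)
    exact (h i hi j hj hij).trans (ZMod.val_lt _).le
  -- The blocks of `g` consecutive residues starting at the elements of `J` are disjoint.
  have key : ∀ i ∈ J, ∀ i' ∈ J, ∀ m m' : ℕ, m' < g → m ≤ m' → i + (m : ZMod c) = i' + m' →
      i = i' ∧ m = m' := by
    intro i hi i' hi' m m' hm' hmm heq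
    have h1 : i - i' = ((m' - m : ℕ) : ZMod c) := by
      rw [Nat.cast_sub hmm, sub_eq_sub_iff_add_eq_add, heq, add_comm]
    have h2 : (i - i').val = m' - m := by
      rw [h1, ZMod.val_natCast_of_lt (by omega)]
    by_cases hii : i = i'
    · refine ⟨hii, ?_⟩
      rw [hii, sub_self, ZMod.val_zero] at h2
      omega
    · have := h i' hi' i hi (Ne.symm hii)
      omega
  have := Finset.card_le_card_of_injOn (s := J ×ˢ Finset.range g) (t := (Finset.univ : Finset (ZMod c)))
    (fun p => p.1 + (p.2 : ZMod c)) (fun _ _ => by simp) (by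
      rintro ⟨i, m⟩ h1 ⟨i', m'⟩ h2 heq
      simp only [Finset.coe_product, Set.mem_prod, Finset.mem_coe, Finset.mem_range] at h1 h2 heq
      rcases le_total m m' with hm | hm
      · obtain ⟨h3, h4⟩ := key i h1.1 i' h2.1 m m' h2.2 hm heq
        rw [h3, h4]
      · obtain ⟨h3, h4⟩ := key i' h2.1 i h1.1 m' m h1.2 hm heq.symm
        rw [h3, h4])
  simpa [ZMod.card] using this

namespace SimpleGraph

/-! ### Edges with many common neighbours, and separating pairs -/

section Thick

open scoped Classical

variable {V : Type*} {G : SimpleGraph V} {c : ℕ} {φ : ZMod c → V} {H : Finset V}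

theorem IsAttached.exists_adj (hH : IsAttached G φ H) {v w : V} (hv : v ∈ H) (hw : w ∈ H)
    (hvw : v ≠ w) : ∃ r ∈ H, G.Adj v r := by
  rcases Relation.ReflTransGen.cases_head (hH.connected v hv w hw) with h | ⟨r, h, -⟩
  exacts [absurd h hvw, ⟨r, h.2, h.1⟩]

/-- Take a longest ear that passes through `v` and then directly to some `r'`. Common neighbours of
`v` and `r'` in `H` already lie on it, as they could be inserted otherwise. The ear has at most `c /
2 - 1` vertices, so at most `c / 2 - 3` common neighbours are in `H` and at least two are on the
cycle. -/
theorem IsAttached.two_le_card_cycleNbrs [NeZero c] (hH : IsAttached G φ H) {v r : V} (hv : v ∈ H)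
    (hr : r ∈ H) (hvr : G.Adj v r)
    (hthick : ∀ r ∈ H, G.Adj v r → c / 2 - 1 ≤ commonCard G φ H v r) :
    2 ≤ (cycleNbrs G φ v).card := by
  obtain ⟨n, ⟨i, j, r', l₁, l₂, h, rfl⟩, hmax⟩ := Nat.exists_maximal_of_bounded
    (P := fun n => ∃ i j r' l₁ l₂, IsEar G φ H i j (l₁ ++ v :: r' :: l₂) ∧
      (l₁ ++ v :: r' :: l₂).length = n) (b := c / 2)
    (by rintro _ ⟨i, j, r', l₁, l₂, h, rfl⟩; exact (h.length_lt hH).le)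
    (by
      obtain ⟨i, j, l₁, l₂, h⟩ := hH.exists_ear_through hv hr hvr
      exact ⟨_, i, j, r, l₁, l₂, h, rfl⟩)
  have hvr' : G.Adj v r' := by
    have := h.chain
    simp only [List.append_assoc, List.cons_append] at this
    rw [List.isChain_cons_append_cons_cons] at this
    exact this.2.1
  have hsub : insert v (insert r' (H.filter fun w => G.Adj v w ∧ G.Adj r' w)) ⊆
      (l₁ ++ v :: r' :: l₂).toFinset := by
    intro w hw
    rw [List.mem_toFinset]
    by_contra hwl
    have hw' : w ∈ H ∧ G.Adj v w ∧ G.Adj r' w := by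
      simp at hw hwl
      tauto
    have := hmax _ ⟨i, j, w, l₁, r' :: l₂, h.insert hw'.1 hwl hw'.2.1 hw'.2.2, rfl⟩
    simp at this
  have hcard := (Finset.card_le_card hsub).trans (List.toFinset_card_le _)
  rw [Finset.card_insert_of_notMem (by simp [hvr'.ne]), Finset.card_insert_of_notMem (by simp)]
    at hcard
  have hlen := h.length_lt hH
  have hth := hthick r' (h.mem r' (by simp)) hvr'
  have hint : (cycleNbrs G φ v ∩ cycleNbrs G φ r').card ≤ (cycleNbrs G φ v).card :=
    Finset.card_le_card Finset.inter_subset_left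
  unfold commonCard at hth
  omega

theorem IsAttached.three_le_val_sub (hH : IsAttached G φ H) {i j : ZMod c} {u w : V} (hu : u ∈ H)
    (hw : w ∈ H) (hui : G.Adj u (φ i)) (hwj : G.Adj w (φ j)) (hij : i ≠ j) (huw : u ≠ w) :
    3 ≤ (j - i).val := by
  obtain ⟨l, hl, hul, hwl⟩ := hH.exists_ear_of_adj hij hu hw hui hwj
  have := hH.length_ear _ _ _ hl
  have : ({u, w} : Finset V).card ≤ l.toFinset.card :=
    Finset.card_le_card (by simp [Finset.insert_subset_iff, hul, hwl])
  rw [Finset.card_pair huw] at this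
  have := l.toFinset_card_le
  omega

theorem Escapes.step {S : Set V} {a b : V} (hb : Escapes G φ H S b) (hab : G.Adj a b) (hbH : b ∈ H)
    (hbS : b ∉ S) : Escapes G φ H S a := by
  obtain ⟨t, i, h, hi⟩ := hb
  exact ⟨t, i, Relation.ReflTransGen.head ⟨hab, hbH, hbS⟩ h, hi⟩

theorem Escapes.of_adj {S : Set V} {a : V} {i : ZMod c} (hi : G.Adj a (φ i)) (hS : φ i ∉ S) :
    Escapes G φ H S a :=
  ⟨a, i, .refl, hi, hS⟩

/-- All vertices on an escape route from `S` escape `S` themselves, so the route never meets a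
trapped vertex. -/
theorem Escapes.mono_of_not_escapes {S T : Set V} {a : V} (ha : Escapes G φ H S a)
    (hT : ∀ s ∈ T, s ∈ H ∧ (s ∈ S ∨ ¬ Escapes G φ H S s)) (hφ : ∀ i, φ i ∉ H) :
    Escapes G φ H T a := by
  obtain ⟨t, i, h, hi, hiS⟩ := ha
  have hiT : φ i ∉ T := fun h => hφ i (hT _ h).1
  induction h using Relation.ReflTransGen.head_induction_on with
  | refl => exact .of_adj hi hiT
  | @head a b hab hbt ih =>
    refine ih.step hab.1 hab.2.1 fun hbT => ?_
    rcases (hT b hbT).2 with hb | hb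
    exacts [hab.2.2 hb, hb ⟨t, i, hbt, hi, hiS⟩]

/-- Some walk from `x` reaches the cycle while avoiding `y`. After its last visit to `x` all its
vertices escape `{x, y}`, hence lie outside `T`. -/
theorem IsAttached.escapes_of_not_escapes (hH : IsAttached G φ H) {x y : V} {T : Set V}
    (hx : x ∈ H) (hy : y ∈ H) (hxy : x ≠ y)
    (hT : ∀ s ∈ T, s ∈ H ∧ (s = y ∨ ¬ Escapes G φ H {x, y} s)) : Escapes G φ H T x := by
  obtain ⟨t, i, h, hi, -⟩ := hH.escapes y x (Or.inl hy) hx hxy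
  have hiT : φ i ∉ T := fun h => hH.notMem i (hT _ h).1
  have hixy : φ i ∉ ({x, y} : Set V) := by
    rintro (h | h)
    exacts [hH.notMem i (h ▸ hx), hH.notMem i (h ▸ hy)]
  have hT' : ∀ s ∈ T, s ∈ H ∧ (s ∈ ({x, y} : Set V) ∨ ¬ Escapes G φ H {x, y} s) :=
    fun s hs => ⟨(hT s hs).1, (hT s hs).2.imp_left fun h => by simp [h]⟩
  suffices ∀ a, Relation.ReflTransGen (fun a b => G.Adj a b ∧ b ∈ H ∧ b ∉ ({y} : Set V)) a t →
      Escapes G φ H T x ∨ a ≠ x ∧ Escapes G φ H {x, y} a from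
    (this x h).resolve_right fun h => h.1 rfl
  intro a ha
  induction ha using Relation.ReflTransGen.head_induction_on with
  | refl =>
    by_cases htx : t = x
    · exact Or.inl (.of_adj (htx ▸ hi) hiT)
    · exact Or.inr ⟨htx, .of_adj hi hixy⟩
  | @head a b hab hbt ih =>
    rcases ih with ih | ⟨hbx, hb⟩
    · exact Or.inl ih
    have hby : b ≠ y := by simpa using hab.2.2
    by_cases hax : a = x
    · subst hax
      refine Or.inl ((hb.mono_of_not_escapes hT' hH.notMem).step hab.1 hab.2.1 fun hbT => ?_)
      rcases (hT b hbT).2 with h | h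
      exacts [hby h, h hb]
    · exact Or.inr ⟨hax, hb.step hab.1 hab.2.1 (by simp [hbx, hby])⟩

/-- If every edge whose contraction is harmless has many common neighbours, then every edge is
harmless. -/
theorem IsAttached.forall_escapes [NeZero c] (hH : IsAttached G φ H)
    (hthick : ∀ x ∈ H, ∀ y ∈ H, G.Adj x y → (∀ s ∈ H, s ≠ x → s ≠ y → Escapes G φ H {x, y} s) →
      c / 2 - 1 ≤ commonCard G φ H x y) {x y : V} (hx : x ∈ H) (hy : y ∈ H) (hxy : G.Adj x y) :
    ∀ s ∈ H, s ≠ x → s ≠ y → Escapes G φ H {x, y} s := by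
  induction hn : (H.filter fun s => s ≠ x ∧ s ≠ y ∧ ¬ Escapes G φ H {x, y} s).card using
    Nat.strong_induction_on generalizing x y with
  | _ n ih =>
  by_contra! hbad
  obtain ⟨s, hs, hsx, hsy, hsE⟩ := hbad
  have hixy : ∀ i, φ i ∉ ({x, y} : Set V) := by
    rintro i (h | h)
    exacts [hH.notMem i (h ▸ hx), hH.notMem i (h ▸ hy)]
  -- The pair `{s, r}` traps strictly fewer vertices than `{x, y}`: whatever it traps was trapped
  -- before, and `s` no longer counts. So the induction hypothesis applies to every edge at `s`.
  have hall : ∀ r ∈ H, G.Adj s r → c / 2 - 1 ≤ commonCard G φ H s r := by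
    intro r hr hsr
    refine hthick s hs r hr hsr (ih _ ?_ hs hr hsr rfl)
    have hrD : r = x ∨ r = y ∨ ¬ Escapes G φ H {x, y} r := by
      by_contra! h
      exact hsE (h.2.2.step hsr hr (by simp [h.1, h.2.1]))
    rw [← hn]
    refine Finset.card_lt_card ((Finset.ssubset_iff_of_subset ?_).2
      ⟨s, by simp [hs, hsx, hsy, hsE], by simp⟩)
    intro a ha
    rw [Finset.mem_filter] at ha ⊢
    obtain ⟨haH, has, har, haE⟩ := ha
    refine ⟨haH, ?_, ?_, ?_⟩
    · rintro rfl
      refine haE (hH.escapes_of_not_escapes haH hy hxy.ne ?_)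
      rintro b (rfl | rfl)
      · exact ⟨hs, Or.inr hsE⟩
      · exact ⟨hr, hrD.resolve_left har.symm⟩
    · rintro rfl
      refine haE (hH.escapes_of_not_escapes haH hx hxy.ne' ?_)
      rw [Set.pair_comm a x]
      rintro b (rfl | rfl)
      · exact ⟨hs, Or.inr hsE⟩
      · refine ⟨hr, ?_⟩
        rcases hrD with h | h | h
        exacts [Or.inl h, absurd h har.symm, Or.inr h]
    · intro haE'
      refine haE (haE'.mono_of_not_escapes ?_ hH.notMem)
      rintro b (rfl | rfl)
      · exact ⟨hs, Or.inr hsE⟩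
      · refine ⟨hr, ?_⟩
        rcases hrD with h | h | h
        exacts [Or.inl (by simp [h]), Or.inl (by simp [h]), Or.inr h]
  obtain ⟨r, hr, hsr⟩ := hH.exists_adj hs hx hsx
  have h2 := hH.two_le_card_cycleNbrs hs hr hsr hall
  obtain ⟨i, hi⟩ := Finset.card_pos.1 (show 0 < (cycleNbrs G φ s).card by omega)
  exact hsE (.of_adj (mem_cycleNbrs.1 hi) (hixy i))

/-! ### Longest closed paths when all edges have many common neighbours -/

/-- `R` is a path in `H` from `x` to `y` whose ends are adjacent. -/
structure IsClosedPath (G : SimpleGraph V) (H : Finset V) (x y : V) (R : List V) : Prop where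
  chain : R.IsChain G.Adj
  nodup : R.Nodup
  mem : ∀ v ∈ R, v ∈ H
  head : R.head? = some x
  last : R.getLast? = some y
  adj : G.Adj x y

theorem IsClosedPath.exists_rotate {x y v : V} {R : List V} (h : IsClosedPath G H x y R)
    (hv : v ∈ R) : ∃ w R', IsClosedPath G H v w R' ∧ R'.Perm R := by
  obtain ⟨l₁, l₂, rfl⟩ := List.append_of_mem hv
  rcases List.eq_nil_or_concat l₁ with rfl | ⟨l, w, rfl⟩
  · obtain rfl : v = x := by simpa using h.head
    exact ⟨y, _, h, .refl _⟩
  · rw [List.concat_eq_append] at h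
    rw [List.concat_eq_append]
    have hperm : (v :: l₂ ++ (l ++ [w])).Perm (l ++ [w] ++ v :: l₂) := List.perm_append_comm
    refine ⟨w, v :: l₂ ++ (l ++ [w]), ⟨?_, hperm.nodup_iff.2 h.nodup, ?_, by simp,
      by rw [List.getLast?_append]; simp, ?_⟩, hperm⟩
    · have hc := List.isChain_append.1 h.chain
      refine List.isChain_append.2 ⟨hc.2.1, hc.1, ?_⟩
      intro a ha b hb
      have h1 := h.last
      have h2 := h.head
      rw [List.getLast?_append] at h1
      rw [List.head?_append] at h2
      rw [Option.mem_def] at ha hb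
      rw [ha] at h1
      rw [hb] at h2
      simp at h1 h2
      rw [h1, h2]
      exact h.adj.symm
    · exact fun a ha => h.mem a (hperm.mem_iff.1 ha)
    · have hc := h.chain
      rw [List.append_assoc, List.singleton_append, List.isChain_append_cons_cons] at hc
      exact hc.2.1.symm

theorem IsClosedPath.append {x y t : V} {R : List V} (h : IsClosedPath G H x y R) (ht : t ∈ H)
    (htR : t ∉ R) (hx : G.Adj x t) (hy : G.Adj y t) : IsClosedPath G H x t (R ++ [t]) where
  chain := List.isChain_append.2 ⟨h.chain, by simp, fun a ha b hb => by
    rw [h.last] at ha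
    simp at ha hb
    exact ha ▸ hb ▸ hy⟩
  nodup := List.nodup_append.2 ⟨h.nodup, by simp, fun a ha b hb => by
    rw [List.mem_singleton] at hb
    rintro rfl
    exact htR (hb ▸ ha)⟩
  mem := by
    have := h.mem
    simp
    grind
  head := by simp [h.head]
  last := by simp
  adj := hx

/-- Both ends of the path have two neighbours on the cycle, so distinct feet can be chosen to extend
it to an ear. -/
theorem IsAttached.length_lt_of_isChain [NeZero c] (hH : IsAttached G φ H)
    (hA : ∀ v ∈ H, 2 ≤ (cycleNbrs G φ v).card) {R : List V} {x : V} (hx : R.head? = some x)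
    (hR : R.IsChain G.Adj) (hn : R.Nodup) (hm : ∀ v ∈ R, v ∈ H) : R.length < c / 2 := by
  have hne : R ≠ [] := by rintro rfl; simp at hx
  have hy := List.getLast?_eq_some_getLast hne
  set y := R.getLast hne
  obtain ⟨i, hi⟩ := Finset.card_pos.1
    (show 0 < (cycleNbrs G φ x).card by have := hA x (hm x (List.mem_of_mem_head? hx)); omega)
  obtain ⟨j, hj, hji⟩ := Finset.exists_mem_ne
    (show 1 < (cycleNbrs G φ y).card by have := hA y (hm y (List.getLast_mem hne)); omega) i
  exact (isEar_of_isChain hji.symm hR hn hm hx hy (mem_cycleNbrs.1 hi)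
    (mem_cycleNbrs.1 hj)).length_lt hH

/-- Between any two common neighbours of `x` and `y` on the cycle, in either order, `R` is an ear;
so they are spaced at least `R.length + 1` apart. -/
theorem IsAttached.card_inter_mul_le [NeZero c] (hH : IsAttached G φ H) {R : List V} {x y : V}
    (hR : IsClosedPath G H x y R) (h2 : 2 ≤ (cycleNbrs G φ x ∩ cycleNbrs G φ y).card) :
    (cycleNbrs G φ x ∩ cycleNbrs G φ y).card * (R.length + 1) ≤ c := by
  refine ZMod.card_mul_le_of_forall_le_val_sub h2 fun i hi j hj hij => ?_
  simp only [Finset.mem_inter, mem_cycleNbrs] at hi hj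
  exact hH.length_ear i j R
    (isEar_of_isChain hij hR.chain hR.nodup hR.mem hR.head hR.last hi.1 hj.2)

/-- Let `φ j` be a neighbour of `w`. By the ear along `R`, any other neighbour of `v` on the cycle
is at distance at least `c / 2` from it both ways round. Two such neighbours would be at most one
step apart, but the ear `[v]` requires two steps. -/
theorem IsAttached.card_cycleNbrs_le_two [NeZero c] (hH : IsAttached G φ H) {R : List V} {v w : V}
    (hR : IsClosedPath G H v w R) (hlen : c / 2 ≤ R.length + 1)
    (hw : 1 ≤ (cycleNbrs G φ w).card) : (cycleNbrs G φ v).card ≤ 2 := by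
  by_contra! hlt
  obtain ⟨j, hj⟩ := Finset.card_pos.1 hw
  rw [mem_cycleNbrs] at hj
  obtain ⟨a, ha, b, hb, hab⟩ := Finset.one_lt_card.1
    (show 1 < ((cycleNbrs G φ v).erase j).card by
      have := Finset.pred_card_le_card_erase (s := cycleNbrs G φ v) (a := j)
      omega)
  simp only [Finset.mem_erase, mem_cycleNbrs] at ha hb
  have hvH : v ∈ H := hR.mem v (List.mem_of_mem_head? hR.head)
  have hval : ∀ i, i ≠ j → G.Adj v (φ i) → c / 2 ≤ (i - j).val ∧ c / 2 ≤ c - (i - j).val := by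
    intro i hij hi
    have hear := isEar_of_isChain hij hR.chain hR.nodup hR.mem hR.head hR.last hi hj
    have h1 := hH.length_ear _ _ _ hear
    have h2 := hH.length_ear _ _ _ hear.reverse
    have : NeZero (i - j) := ⟨sub_ne_zero.2 hij⟩
    rw [← neg_sub i j, ZMod.val_neg_of_ne_zero] at h1
    rw [List.length_reverse] at h2
    omega
  have key : ∀ a b, a ≠ b → G.Adj v (φ a) → G.Adj v (φ b) → a ≠ j → b ≠ j →
      (a - j).val ≤ (b - j).val → False := by
    intro a b hab ha hb haj hbj hle
    have h1 := hH.length_ear a b [v] (isEar_of_isChain hab (by simp) (by simp) (by simpa)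
      (x := v) (y := v) (by simp) (by simp) ha hb)
    rw [← sub_sub_sub_cancel_right b a j, ZMod.val_sub hle] at h1
    have := hval a haj ha
    have := hval b hbj hb
    have := (b - j).val_lt
    simp at h1
    omega
  rcases le_total (a - j).val (b - j).val with h | h
  · exact key a b hab ha.2 hb.2 ha.1 hb.1 h
  · exact key b a hab.symm hb.2 ha.2 hb.1 ha.1 h

/-- If all edges of `H` have many common neighbours, then `H` has `c / 2 - 1` vertices. -/
theorem IsAttached.attachedWeight_le_of_thick [NeZero c] (hH : IsAttached G φ H) (hc : 10 ≤ c)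
    (hcard : 1 < H.card)
    (hthick : ∀ x ∈ H, ∀ y ∈ H, G.Adj x y → c / 2 - 1 ≤ commonCard G φ H x y) :
    attachedWeight G φ H ≤ H.card * (2 * (c / 2 - 1)) := by
  have hnb : ∀ v ∈ H, ∃ r ∈ H, G.Adj v r := fun v hv => by
    obtain ⟨w, hw, hwv⟩ := Finset.exists_mem_ne hcard v
    exact hH.exists_adj hv hw hwv.symm
  have hA : ∀ v ∈ H, 2 ≤ (cycleNbrs G φ v).card := fun v hv => by
    obtain ⟨r, hr, hvr⟩ := hnb v hv
    exact hH.two_le_card_cycleNbrs hv hr hvr (hthick v hv)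
  have hlt := fun (R : List V) (x y : V) (h : IsClosedPath G H x y R) =>
    hH.length_lt_of_isChain hA h.head h.chain h.nodup h.mem
  obtain ⟨n, ⟨x, y, R, hR, rfl⟩, hmax⟩ := Nat.exists_maximal_of_bounded
    (P := fun n => ∃ x y R, IsClosedPath G H x y R ∧ R.length = n) (b := c / 2)
    (by rintro _ ⟨x, y, R, h, rfl⟩; exact (hlt R x y h).le)
    (by
      obtain ⟨v, hv⟩ := Finset.card_pos.1 (show 0 < H.card by omega)
      obtain ⟨r, hr, hvr⟩ := hnb v hv
      -- A single edge counts as a closed path, so the maximum is over a nonempty set.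
      exact ⟨_, v, r, [v, r], ⟨by simpa, by simpa using hvr.ne, by simp [hv, hr], rfl, rfl, hvr⟩, rfl⟩)
  have hxR : x ∈ R := List.mem_of_mem_head? hR.head
  have hyR : y ∈ R := List.mem_of_getLast? hR.last
  have hsub : insert x (insert y (H.filter fun w => G.Adj x w ∧ G.Adj y w)) ⊆ R.toFinset := by
    intro w hw
    rw [List.mem_toFinset]
    by_contra hwR
    simp only [Finset.mem_insert, Finset.mem_filter] at hw
    rcases hw with rfl | rfl | ⟨hwH, hxw, hyw⟩
    · exact hwR hxR
    · exact hwR hyR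
    · have := hmax _ ⟨x, w, _, hR.append hwH hwR hxw hyw, rfl⟩
      simp at this
  have hcardR := (Finset.card_le_card hsub).trans (List.toFinset_card_le _)
  rw [Finset.card_insert_of_notMem (by simp [hR.adj.ne]), Finset.card_insert_of_notMem (by simp)]
    at hcardR
  have hth := hthick x (hR.mem x hxR) y (hR.mem y hyR) hR.adj
  unfold commonCard at hth
  have hltR := hlt R x y hR
  have hmul := hH.card_inter_mul_le hR (by omega)
  -- At most `R.length - 2` common neighbours of `x` and `y` are in `H`, leaving at least `d + 3` on
  -- the cycle. With `L = R.length`, `h1` and `h3` give `d * (L - 1) + (L - 2) ≤ 0`, so `L = 2` and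
  -- `d = 0`; this is ruled out by `c ≥ 10`.
  have hlen : R.length + 1 = c / 2 := by
    by_contra hne
    obtain ⟨d, hd⟩ : ∃ d, c / 2 = R.length + 2 + d := ⟨c / 2 - (R.length + 2), by omega⟩
    have h1 : (d + 3) * (R.length + 1) ≤ c := (Nat.mul_le_mul_right _ (by omega)).trans hmul
    have h2 : 2 ≤ R.length := by omega
    have h3 : c ≤ 2 * (R.length + 2 + d) + 1 := by omega
    have h4 : 5 ≤ R.length + 2 + d := by omega
    nlinarith
  -- A vertex off `R` adjacent to it could be put in front of `R`, cut open at its neighbour, giving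
  -- a path with `c / 2` vertices.
  have hHR : ∀ v ∈ H, v ∈ R := by
    intro v hv
    have := hH.connected x (hR.mem x hxR) v hv
    clear hv
    induction this with
    | refl => exact hxR
    | @tail a b _ hab ih =>
      by_contra hb
      obtain ⟨w, R', hR', hperm⟩ := hR.exists_rotate ih
      have := hH.length_lt_of_isChain hA (R := b :: R') (x := b) rfl
        (List.isChain_cons.2 ⟨fun z hz => by
          rw [hR'.head] at hz
          simp at hz
          exact hz ▸ hab.1.symm, hR'.chain⟩)
        (List.nodup_cons.2 ⟨fun h => hb (hperm.mem_iff.1 h), hR'.nodup⟩)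
        (by simpa [hab.2] using hR'.mem)
      rw [List.length_cons, hperm.length_eq] at this
      omega
  have hHcard : H.card ≤ R.length :=
    (Finset.card_le_card fun v hv => List.mem_toFinset.2 (hHR v hv)).trans (List.toFinset_card_le _)
  refine Finset.sum_le_card_nsmul _ _ _ fun v hv => ?_
  obtain ⟨w, R', hR', hperm⟩ := hR.exists_rotate (hHR v hv)
  have h1 := hH.card_cycleNbrs_le_two hR' (by rw [hperm.length_eq]; omega)
    (by have := hA w (hR'.mem w (List.mem_of_getLast? hR'.last)); omega)
  have h2 : (H.filter (G.Adj v)).card ≤ (H.erase v).card :=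
    Finset.card_le_card fun w hw => by
      rw [Finset.mem_filter] at hw
      exact Finset.mem_erase.2 ⟨hw.2.ne', hw.1⟩
  rw [Finset.card_erase_of_mem hv] at h2
  omega

/-- A connected set `H` off the cycle whose feet are few meets few edges. -/
theorem IsAttached.attachedWeight_le [NeZero c] (hH : IsAttached G φ H) (hc : 10 ≤ c)
    (hfeet : (feet G φ H).card ≤ c / 2 - 1) :
    attachedWeight G φ H ≤ H.card * (2 * (c / 2 - 1)) := by
  induction hn : H.card using Nat.strong_induction_on generalizing G H with
  | _ n ih =>
  rcases Nat.lt_or_ge 1 n with h1 | h1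
  · by_cases hthin : ∃ x ∈ H, ∃ y ∈ H, G.Adj x y ∧
        (∀ s ∈ H, s ≠ x → s ≠ y → Escapes G φ H {x, y} s) ∧ commonCard G φ H x y < c / 2 - 1
    · obtain ⟨x, hx, y, hy, hxy, hgood, hlt⟩ := hthin
      have hcard : (H.erase y).card = n - 1 := by rw [Finset.card_erase_of_mem hy, hn]
      have := ih (n - 1) (by omega) (hH.contractInto hx hy hxy hgood)
        ((Finset.card_le_card (feet_contractInto_subset hH.notMem hx hy)).trans hfeet) hcard
      rw [attachedWeight_contractInto hH.notMem hx hy hxy]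
      -- The contraction costs at most `c / 2 - 1` edges, the allowance of one vertex.
      obtain ⟨m, rfl⟩ : ∃ m, n = m + 1 := ⟨n - 1, by omega⟩
      rw [Nat.add_mul, one_mul]
      rw [Nat.add_sub_cancel] at this
      omega
    · push Not at hthin
      rw [← hn]
      refine hH.attachedWeight_le_of_thick hc (by omega) fun x hx y hy hxy =>
        hthin x hx y hy hxy (hH.forall_escapes hthin hx hy hxy)
  -- The bound on the feet is needed for a single remaining vertex, all of whose edges go to feet.
  · rcases H.eq_empty_or_nonempty with rfl | ⟨v, hv⟩
    · simp [attachedWeight]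
    · obtain rfl : H = {v} := by
        refine Finset.eq_singleton_iff_unique_mem.2 ⟨hv, fun w hw => ?_⟩
        exact Finset.card_le_one.1 (hn.trans_le h1) w hw v hv
      have : (({v} : Finset V).filter (G.Adj v)).card = 0 := by simp
      simp only [attachedWeight, Finset.sum_singleton, this]
      simp only [feet, Finset.singleton_biUnion] at hfeet
      rw [Finset.card_singleton] at hn
      subst hn
      omega

end Thick

/-! ### The number of feet -/

section Feet

open scoped Classical

variable {V : Type*} {G : SimpleGraph V} {c : ℕ} [NeZero c] {φ : ZMod c → V} {H : Finset V}

theorem mem_feet {i : ZMod c} : i ∈ feet G φ H ↔ ∃ t ∈ H, G.Adj t (φ i) := by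
  simp [feet]

theorem IsAttached.two_le_val_sub (hH : IsAttached G φ H) {i j : ZMod c} (hi : i ∈ feet G φ H)
    (hj : j ∈ feet G φ H) (hij : i ≠ j) : 2 ≤ (j - i).val := by
  obtain ⟨u, hu, hui⟩ := mem_feet.1 hi
  obtain ⟨w, hw, hwj⟩ := mem_feet.1 hj
  obtain ⟨l, hl, hul, -⟩ := hH.exists_ear_of_adj hij hu hw hui hwj
  have := hH.length_ear _ _ _ hl
  have := List.length_pos_of_mem hul
  omega

/-- A maximum number of feet forces all feet to be at distance two, hence to come from one vertex,
which is impossible if `H` has two vertices. -/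
theorem IsAttached.card_feet_le (hH : IsAttached G φ H) (hc : 10 ≤ c) (hcard : 1 < H.card) :
    (feet G φ H).card ≤ c / 2 - 1 := by
  by_contra! hlt
  set U := feet G φ H with hU
  have hv1 : (1 : ZMod c).val = 1 := by
    have := ZMod.val_natCast_of_lt (show 1 < c by omega)
    rwa [Nat.cast_one] at this
  have hv2 : (2 : ZMod c).val = 2 := ZMod.val_natCast_of_lt (show 2 < c by omega)
  have hsucc : ∀ i ∈ U, i + 1 ∉ U := by
    intro i hi hi1
    have := hH.two_le_val_sub hi hi1 (by
      intro h
      have : (1 : ZMod c) = 0 := by simpa using h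
      rw [this, ZMod.val_zero] at hv1
      omega)
    rw [add_sub_cancel_left, hv1] at this
    omega
  have huniq : ∀ i, ∀ u ∈ H, ∀ w ∈ H, G.Adj u (φ i) → G.Adj w (φ (i + 2)) → u = w := by
    intro i u hu w hw hui hwi
    by_contra huw
    have := hH.three_le_val_sub hu hw hui hwi (by
      intro h
      have : (2 : ZMod c) = 0 := by simpa using h
      rw [this, ZMod.val_zero] at hv2
      omega) huw
    rw [add_sub_cancel_left, hv2] at this
    omega
  -- `U` and `U + 1` are disjoint and together have at least `2 * (c / 2) ≥ c - 1` elements, so they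
  -- miss at most one residue. That residue is `e` if it exists; otherwise `e` is the predecessor of
  -- any foot.
  obtain ⟨e, heU, he1, hcov⟩ : ∃ e, e ∉ U ∧ e + 1 ∈ U ∧ ∀ z, z ∈ U ∨ z - 1 ∈ U ∨ z = e := by
    by_cases he : ∃ e, e ∉ U ∧ e - 1 ∉ U
    · obtain ⟨e, he, he'⟩ := he
      have hcov : ∀ z, z ∈ U ∨ z - 1 ∈ U ∨ z = e := by
        by_contra! hz
        obtain ⟨z, hz, hz', hze⟩ := hz
        have hdisj : Disjoint U (U.image (· + 1)) := by
          rw [Finset.disjoint_left]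
          intro a ha ha'
          obtain ⟨b, hb, rfl⟩ := Finset.mem_image.1 ha'
          exact hsucc b hb ha
        have hsub : U ∪ U.image (· + 1) ⊆ ((Finset.univ : Finset (ZMod c)).erase z).erase e := by
          intro a ha
          have hcase : ∀ y, y ∉ U → y - 1 ∉ U → a ≠ y := by
            rintro y hy hy' rfl
            rcases Finset.mem_union.1 ha with ha | ha
            · exact hy ha
            · obtain ⟨b, hb, rfl⟩ := Finset.mem_image.1 ha
              exact hy' (by simpa using hb)
          simp [hcase e he he', hcase z hz hz']
        have := Finset.card_le_card hsub
        rw [Finset.card_union_of_disjoint hdisj,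
          Finset.card_image_of_injective _ (add_left_injective 1),
          Finset.card_erase_of_mem (by simp [hze.symm]), Finset.card_erase_of_mem (by simp),
          Finset.card_univ, ZMod.card] at this
        omega
      refine ⟨e, he, ?_, hcov⟩
      rcases hcov (e + 1) with h | h | h
      · exact h
      · exact absurd (by simpa using h) he
      · have : (1 : ZMod c) = 0 := by simpa using h
        rw [this, ZMod.val_zero] at hv1
        omega
    · push Not at he
      obtain ⟨i, hi⟩ := Finset.card_pos.1 (show 0 < U.card by omega)
      refine ⟨i - 1, fun h => hsucc _ h (by simpa using hi), by simpa using hi, fun z => ?_⟩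
      by_cases hz : z ∈ U
      exacts [Or.inl hz, Or.inr (Or.inl (he z hz))]
  have hstep : ∀ n : ℕ, 2 * n + 3 < c → e + 1 + (2 * n : ℕ) ∈ U → e + 1 + (2 * n : ℕ) + 2 ∈ U := by
    intro n hn h
    rcases hcov (e + 1 + (2 * n : ℕ) + 2) with h' | h' | h'
    · exact h'
    · refine absurd ?_ (hsucc _ h)
      convert h' using 1
      ring
    · have h0 : ((2 * n + 3 : ℕ) : ZMod c) = 0 := by
        push_cast at h' ⊢
        linear_combination h'
      have := ZMod.val_natCast_of_lt hn
      rw [h0, ZMod.val_zero] at this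
      omega
  obtain ⟨t, ht, hte⟩ := mem_feet.1 (by simpa using hstep 0 (by omega) (by simpa using he1))
  -- Starting at `e + 1`, every second residue is a foot, and by `huniq` the same vertex `t` is the
  -- only one attached to each.
  have hall : ∀ n : ℕ, 2 * n + 1 < c → e + 1 + (2 * n : ℕ) ∈ U ∧
      ∀ w ∈ H, G.Adj w (φ (e + 1 + (2 * n : ℕ))) → w = t := by
    intro n
    induction n with
    | zero =>
      intro _
      refine ⟨by simpa using he1, fun w hw hwe => huniq (e + 1) w hw t ht (by simpa using hwe) hte⟩
    | succ n ih =>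
      intro hn
      obtain ⟨h1, h2⟩ := ih (by omega)
      have heq : e + 1 + ((2 * (n + 1) : ℕ) : ZMod c) = e + 1 + (2 * n : ℕ) + 2 := by
        push_cast
        ring
      rw [heq]
      refine ⟨hstep n (by omega) h1, fun w hw hwe => ?_⟩
      obtain ⟨u, hu, hue⟩ := mem_feet.1 h1
      rw [← huniq _ u hu w hw hue hwe]
      exact h2 u hu hue
  -- Since `t` does not separate `v` from the cycle, some `t' ≠ t` has a foot `i`. Its offset from
  -- `e + 1` can be neither even, where `t` is alone, nor odd, where it would follow another foot or
  -- equal `e`.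
  obtain ⟨v, hv, hvt⟩ := Finset.exists_mem_ne hcard t
  obtain ⟨t', i, hr, hi, -⟩ := hH.escapes t v (Or.inl ht) hv hvt
  have ht' : t' ∈ H ∧ t' ≠ t := by
    rcases Relation.ReflTransGen.cases_tail hr with h | ⟨_, -, h⟩
    exacts [h ▸ ⟨hv, hvt⟩, ⟨h.2.1, by simpa using h.2.2⟩]
  have hiU : i ∈ U := mem_feet.2 ⟨t', ht'.1, hi⟩
  have him : i = e + 1 + ((i - (e + 1)).val : ZMod c) := by
    rw [ZMod.natCast_val, ZMod.cast_id, add_sub_cancel]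
  have hmc := (i - (e + 1)).val_lt
  generalize (i - (e + 1)).val = m at him hmc
  have hme : m + 1 ≠ c := by
    rintro rfl
    refine heU ?_
    have h0 : ((m + 1 : ℕ) : ZMod (m + 1)) = 0 := ZMod.natCast_self _
    push_cast at h0
    have : i = e := by rw [him]; linear_combination h0
    exact this ▸ hiU
  rcases Nat.even_or_odd' m with ⟨n, rfl | rfl⟩
  · exact ht'.2 ((hall n (by omega)).2 t' ht'.1 (him ▸ hi))
  · refine hsucc _ (hall n (by omega)).1 ?_
    convert hiU using 1
    rw [him]
    push_cast
    ring

theorem degreeIn_eq_card_cycleNbrs (hinj : Function.Injective φ) {S : Set V}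
    (hS : Set.range φ = S) (u : V) :
    G.degreeIn S u = (cycleNbrs G φ u).card := by
  rw [degreeIn, ← Set.ncard_coe_finset, ← Set.ncard_image_of_injective _ hinj]
  congr 1
  ext w
  simp only [Set.mem_inter_iff, mem_neighborSet, ← hS, Set.mem_range, Set.mem_image,
    Finset.mem_coe, mem_cycleNbrs]
  constructor
  · rintro ⟨h, i, rfl⟩
    exact ⟨i, h, rfl⟩
  · rintro ⟨i, h, rfl⟩
    exact ⟨h, i, rfl⟩

end Feet

/-! ### Ears and longest cycles -/

section Cycle

variable {V : Type*} {G : SimpleGraph V}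

theorem exists_isCycle_of_isChain {L : List V} {x y : V} (hL : L.IsChain G.Adj) (hn : L.Nodup)
    (h3 : 3 ≤ L.length) (hx : L.head? = some x) (hy : L.getLast? = some y) (hyx : G.Adj y x) :
    ∃ (w : V) (D : G.Walk w w), D.IsCycle ∧ D.length = L.length := by
  have hne : L ≠ [] := by rintro rfl; simp at hx
  obtain rfl : L.head hne = x := by
    rw [List.head?_eq_some_head hne] at hx
    simpa using hx
  obtain rfl : L.getLast hne = y := by
    rw [List.getLast?_eq_some_getLast hne] at hy
    simpa using hy
  set p := Walk.ofSupport L hne hL with hp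
  have hlen : p.length + 1 = L.length := by
    rw [← Walk.length_support, hp, Walk.support_ofSupport]
  have hpath : p.IsPath := by
    rw [Walk.isPath_def, hp, Walk.support_ofSupport]
    exact hn
  refine ⟨_, Walk.cons hyx p, (Walk.cons_isCycle_iff p hyx).2 ⟨hpath, fun he => ?_⟩, by simpa⟩
  have := hpath.length_eq_one_of_mem_edges (Sym2.eq_swap ▸ he)
  omega

variable {c : ℕ} [NeZero c] {φ : ZMod c → V} {H : Finset V}

/-- Replacing a segment of the cycle `φ` by an ear does not give a longer cycle. -/
theorem IsEar.length_lt_val_sub (hinj : Function.Injective φ)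
    (hadj : ∀ i, G.Adj (φ i) (φ (i + 1)))
    (hmax : ∀ (w : V) (D : G.Walk w w), D.IsCycle → D.length ≤ c) (hφ : ∀ i, φ i ∉ H)
    {i j : ZMod c} {l : List V} (h : IsEar G φ H i j l) : l.length + 1 ≤ (j - i).val := by
  set m := (i - j).val with hm
  have : NeZero (i - j) := ⟨sub_ne_zero.2 h.ne⟩
  have hsub : (j - i).val = c - m := by
    rw [← neg_sub i j]
    exact ZMod.val_neg_of_ne_zero _
  have hmc : m < c := ZMod.val_lt _
  have hm0 : m ≠ 0 := by
    rw [hm, Ne, ZMod.val_eq_zero]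
    exact sub_ne_zero.2 h.ne
  have hjm : j + (m : ZMod c) = i := by
    rw [hm, ZMod.natCast_val, ZMod.cast_id, add_sub_cancel]
  -- `A` is the arc from `φ j` onward to `φ i`; closing it up with `l` gives a cycle of length `m +
  -- 1 + l.length`.
  set A := (List.range (m + 1)).map fun n : ℕ => φ (j + n) with hA
  have hAc : A.IsChain G.Adj := by
    rw [hA, List.isChain_map]
    refine (List.isChain_range_succ _ m).2 fun n _ => ?_
    have := hadj (j + n)
    rwa [add_assoc, ← Nat.cast_succ] at this
  have hAn : A.Nodup := by
    rw [hA, List.nodup_map_iff_inj_on List.nodup_range]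
    intro a ha b hb hab
    have := congrArg ZMod.val (add_left_cancel (hinj hab))
    rw [List.mem_range] at ha hb
    rwa [ZMod.val_natCast_of_lt (by omega), ZMod.val_natCast_of_lt (by omega)] at this
  have hAl : ∀ b ∈ l, b ∉ A := by
    rintro b hb ha
    obtain ⟨n, -, rfl⟩ := List.mem_map.1 ha
    exact hφ _ (h.mem _ hb)
  have hAlast : A.getLast? = some (φ i) := by
    rw [hA, List.range_succ, List.map_append]
    simp [hjm]
  have hch := List.isChain_cons.1 h.chain
  have hlne := List.getLast?_eq_some_getLast h.ne_nil
  obtain ⟨w, D, hD, hlen⟩ := exists_isCycle_of_isChain (L := A ++ l) (x := φ j)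
    (y := l.getLast h.ne_nil) (G := G)
    (List.isChain_append.2 ⟨hAc, hch.2.left_of_append, fun a ha b hb => by
      rw [hAlast] at ha
      simp only [Option.mem_def, Option.some.injEq] at ha
      refine ha ▸ hch.1 b ?_
      rw [Option.mem_def] at hb ⊢
      rw [List.head?_append, hb]
      rfl⟩)
    (List.nodup_append.2 ⟨hAn, h.nodup, fun a ha b hb hab => hAl b hb (hab ▸ ha)⟩)
    (by
      have := List.length_pos_iff.2 h.ne_nil
      simp [hA]
      omega)
    (by simp [hA, List.range_succ_eq_map])
    (by rw [List.getLast?_append, hlne]; rfl)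
    ((List.isChain_append.1 hch.2).2.2 _ hlne _ (by simp))
  have := hmax w D hD
  rw [hlen] at this
  simp [hA] at this
  omega

end Cycle

/-! ### Components of `G - C` and the final count -/

section Components

open scoped Classical

variable {V : Type*} [Fintype V] {G : SimpleGraph V} {S : Set V}

/-- The vertices of a component of `G - S`. -/
noncomputable def componentVerts (G : SimpleGraph V) (S : Set V)
    (K : (G.deleteSet S).ConnectedComponent) : Finset V :=
  (Finset.univ.filter fun u : (Sᶜ : Set V) => (G.deleteSet S).connectedComponentMk u = K).map
    (Function.Embedding.subtype _)

theorem mem_componentVerts {K : (G.deleteSet S).ConnectedComponent} {v : V} :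
    v ∈ componentVerts G S K ↔
      ∃ h : v ∈ Sᶜ, (G.deleteSet S).connectedComponentMk ⟨v, h⟩ = K := by
  simp [componentVerts]

theorem mem_componentVerts_of_adj {K : (G.deleteSet S).ConnectedComponent} {v w : V}
    (hv : v ∈ componentVerts G S K) (hw : w ∉ S) (hvw : G.Adj v w) :
    w ∈ componentVerts G S K := by
  obtain ⟨h, rfl⟩ := mem_componentVerts.1 hv
  exact mem_componentVerts.2 ⟨hw, (ConnectedComponent.connectedComponentMk_eq_of_adj
    (show (G.deleteSet S).Adj ⟨v, h⟩ ⟨w, hw⟩ from hvw)).symm⟩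

variable {c : ℕ} [NeZero c] {φ : ZMod c → V}

theorem IsTwoConnected.isAttached_componentVerts (hG : G.IsTwoConnected) (hc : 2 ≤ c)
    (hinj : Function.Injective φ) (hadj : ∀ i, G.Adj (φ i) (φ (i + 1)))
    (hmax : ∀ (w : V) (D : G.Walk w w), D.IsCycle → D.length ≤ c) (hS : Set.range φ = S)
    (K : (G.deleteSet S).ConnectedComponent) : IsAttached G φ (componentVerts G S K) := by
  have hnot : ∀ i, φ i ∉ componentVerts G S K := fun i hi =>
    (mem_componentVerts.1 hi).1 (hS ▸ ⟨i, rfl⟩)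
  refine ⟨hnot, ?_, ?_, fun i j l h => h.length_lt_val_sub hinj hadj hmax hnot⟩
  · intro u hu w hw
    obtain ⟨hu', rfl⟩ := mem_componentVerts.1 hu
    obtain ⟨hw', h⟩ := mem_componentVerts.1 hw
    have h1 : (G.deleteSet S).Reachable ⟨u, hu'⟩ ⟨w, hw'⟩ := (ConnectedComponent.eq.1 h).symm
    rw [reachable_iff_reflTransGen] at h1
    have key : ∀ b : (Sᶜ : Set V), Relation.ReflTransGen (G.deleteSet S).Adj ⟨u, hu'⟩ b →
        b.1 ∈ componentVerts G S ((G.deleteSet S).connectedComponentMk ⟨u, hu'⟩) ∧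
        Relation.ReflTransGen (fun a b => G.Adj a b ∧
          b ∈ componentVerts G S ((G.deleteSet S).connectedComponentMk ⟨u, hu'⟩)) u b := by
      intro b hb
      induction hb with
      | refl => exact ⟨hu, .refl⟩
      | @tail b d _ hbd ih =>
        have := mem_componentVerts_of_adj ih.1 d.2 hbd
        exact ⟨this, ih.2.tail ⟨hbd, this⟩⟩
    exact (key _ h1).2
  · intro z v _ hv hvz
    obtain ⟨i, hi⟩ : ∃ i, φ i ≠ z := by
      by_contra! h
      have := congrArg ZMod.val (hinj ((h 0).trans (h 1).symm))
      have h1 := ZMod.val_natCast_of_lt (show 1 < c by omega)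
      rw [Nat.cast_one] at h1
      rw [ZMod.val_zero, h1] at this
      omega
    have h := (hG.2.2 z).preconnected ⟨v, hvz⟩ ⟨φ i, hi⟩
    rw [reachable_iff_reflTransGen] at h
    suffices ∀ a : ({z}ᶜ : Set V), Relation.ReflTransGen (G.induce {z}ᶜ).Adj a ⟨φ i, hi⟩ →
        a.1 ∈ componentVerts G S K → Escapes G φ (componentVerts G S K) {z} a from this _ h hv
    intro a ha
    induction ha using Relation.ReflTransGen.head_induction_on with
    | refl => exact fun h => absurd h (hnot i)
    | @head a b hab _ ih =>
      intro haK
      -- A walk avoiding `z` can leave the component only through a cycle vertex other than `z`.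
      by_cases hbS : b.1 ∈ S
      · rw [← hS] at hbS
        obtain ⟨j, hj⟩ := hbS
        have hab' : G.Adj a.1 (φ j) := hj ▸ hab
        exact .of_adj hab' (hj ▸ b.2)
      · have hbK := mem_componentVerts_of_adj haK hbS hab
        exact (ih hbK).step hab hbK b.2

theorem attachedWeight_componentVerts (K : (G.deleteSet S).ConnectedComponent) :
    attachedWeight G φ (componentVerts G S K) =
      ∑ u : (Sᶜ : Set V) with (G.deleteSet S).connectedComponentMk u = K,
        ((G.deleteSet S).degree u + 2 * (cycleNbrs G φ u).card) := by
  rw [attachedWeight, componentVerts, Finset.sum_map]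
  refine Finset.sum_congr rfl fun u hu => ?_
  congr 1
  rw [← card_neighborFinset_eq_degree,
    ← Finset.card_map (Function.Embedding.subtype (· ∈ (Sᶜ : Set V)))]
  congr 1
  ext w
  have huK : u.1 ∈ componentVerts G S K := mem_componentVerts.2 ⟨u.2, (Finset.mem_filter.1 hu).2⟩
  rw [← componentVerts, Finset.mem_filter, Finset.mem_map]
  constructor
  · rintro ⟨hw, huw⟩
    obtain ⟨hwS, -⟩ := mem_componentVerts.1 hw
    exact ⟨⟨w, hwS⟩, by simpa using huw, rfl⟩
  · rintro ⟨w, hw, rfl⟩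
    have huw : G.Adj u.1 w.1 := by simpa using hw
    exact ⟨mem_componentVerts_of_adj huK w.2 huw, huw⟩

theorem two_mul_numEdges_add (hinj : Function.Injective φ) (hS : Set.range φ = S) :
    2 * ((G.deleteSet S).numEdges + (G.between Sᶜ S).numEdges) =
      ∑ u : (Sᶜ : Set V), ((G.deleteSet S).degree u + 2 * (cycleNbrs G φ u).card) := by
  rw [Finset.sum_add_distrib, sum_degrees_eq_twice_card_edges, ← Finset.mul_sum, mul_add]
  congr 2
  · rw [numEdges, ← coe_edgeFinset, Set.ncard_coe_finset]
  · have hb : (G.between Sᶜ S).IsBipartiteWith ↑(Sᶜ : Set V).toFinset ↑S.toFinset := by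
      simpa using between_isBipartiteWith (disjoint_compl_left (a := S))
    rw [numEdges, ← coe_edgeFinset, Set.ncard_coe_finset,
      ← isBipartiteWith_sum_degrees_eq_card_edges hb, ← Finset.sum_coe_sort (Sᶜ : Set V).toFinset]
    refine Fintype.sum_equiv (Equiv.subtypeEquivRight (by simp)) _ _ fun u => ?_
    have hu : u.1 ∉ S := by simpa using u.2
    change _ = (cycleNbrs G φ u.1).card
    rw [← degreeIn_eq_card_cycleNbrs hinj hS, degreeIn, ← card_neighborFinset_eq_degree,
      ← Set.ncard_coe_finset]
    congr 1
    ext w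
    simp [between_adj, hu]

theorem IsTwoConnected.exists_isIsolated (hG : G.IsTwoConnected) (hc : 10 ≤ c)
    (hinj : Function.Injective φ) (hadj : ∀ i, G.Adj (φ i) (φ (i + 1)))
    (hmax : ∀ (w : V) (D : G.Walk w w), D.IsCycle → D.length ≤ c) (hS : Set.range φ = S)
    (he : (c / 2 - 1) * (Fintype.card V - c) <
      (G.deleteSet S).numEdges + (G.between Sᶜ S).numEdges) :
    ∃ u : (Sᶜ : Set V), (G.deleteSet S).IsIsolated u ∧ G.degreeIn S u = c / 2 := by
  by_contra! hno
  have hbound : ∀ K, attachedWeight G φ (componentVerts G S K) ≤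
      (componentVerts G S K).card * (2 * (c / 2 - 1)) := by
    intro K
    have hK := hG.isAttached_componentVerts (by omega) hinj hadj hmax hS K
    refine hK.attachedWeight_le hc ?_
    -- For a one-vertex component the spacing of feet gives only `c / 2`; the assumption `hno` saves
    -- the last unit.
    rcases Nat.lt_or_ge 1 (componentVerts G S K).card with h1 | h1
    · exact hK.card_feet_le hc h1
    · rcases (componentVerts G S K).eq_empty_or_nonempty with h0 | ⟨u, hu⟩
      · simp [h0, feet]
      have huS := (mem_componentVerts.1 hu).1
      have hsing : ∀ w ∈ componentVerts G S K, w = u := fun w hw =>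
        Finset.card_le_one.1 h1 w hw u hu
      have hiso : (G.deleteSet S).IsIsolated ⟨u, huS⟩ := fun w hw =>
        hw.ne' (Subtype.ext (hsing w (mem_componentVerts_of_adj hu w.2 hw)))
      have hle : (feet G φ (componentVerts G S K)).card ≤ c / 2 := by
        by_cases h2 : 2 ≤ (feet G φ (componentVerts G S K)).card
        · have := ZMod.card_mul_le_of_forall_le_val_sub h2
            fun i hi j hj hij => hK.two_le_val_sub hi hj hij
          omega
        · omega
      have hfeet : feet G φ (componentVerts G S K) = cycleNbrs G φ u := by
        rw [Finset.eq_singleton_iff_unique_mem.2 ⟨hu, hsing⟩, feet, Finset.singleton_biUnion]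
      have := hno ⟨u, huS⟩ hiso
      rw [degreeIn_eq_card_cycleNbrs hinj hS, ← hfeet] at this
      omega
  have hcardS : Fintype.card (Sᶜ : Set V) = Fintype.card V - c := by
    have hc' : ∀ _ : Fintype S, Fintype.card S = c := fun _ => by
      rw [← Nat.card_eq_fintype_card, ← hS, Nat.card_range_of_injective hinj, Nat.card_zmod]
    rw [Fintype.card_compl_set, hc']
  have h1 := two_mul_numEdges_add (G := G) hinj hS
  rw [← Finset.sum_fiberwise Finset.univ (G.deleteSet S).connectedComponentMk] at h1
  have h2 : ∑ K, (componentVerts G S K).card = Fintype.card (Sᶜ : Set V) := by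
    simp only [componentVerts, Finset.card_map]
    exact (Finset.card_eq_sum_card_fiberwise (f := (G.deleteSet S).connectedComponentMk)
      (t := Finset.univ) fun _ _ => Finset.mem_univ _).symm.trans Finset.card_univ
  have h3 := Finset.sum_le_sum fun K (_ : K ∈ Finset.univ) => hbound K
  simp only [attachedWeight_componentVerts] at h3
  rw [← Finset.sum_mul, h2, hcardS, ← h1] at h3
  have : (Fintype.card V - c) * (2 * (c / 2 - 1)) = 2 * ((c / 2 - 1) * (Fintype.card V - c)) := by
    ring
  omega

end Components

end SimpleGraph

theorem theorem3p1 {V : Type*} [Fintype V] (G : SimpleGraph V) (hG : G.IsTwoConnected)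
    {v : V} (C : G.Walk v v) (hC : C.IsLongestCycle)
    (hc : 10 ≤ C.length) (hcn : C.length ≤ Fintype.card V - 1)
    (he : (C.length / 2 - 1) * (Fintype.card V - C.length) <
      (G.deleteSet C.verts).numEdges + (G.between C.vertsᶜ C.verts).numEdges) :
    ∃ u : (C.vertsᶜ : Set V),
      (G.deleteSet C.verts).IsIsolated u ∧ G.degreeIn C.verts u = C.length / 2 := by
  have : NeZero C.length := ⟨by omega⟩
  refine hG.exists_isIsolated (φ := fun i : ZMod C.length => C.getVert i.val) hc ?_ ?_ hC.2 ?_ he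
  · intro i j hij
    refine ZMod.val_injective _ (hC.1.getVert_injOn' ?_ ?_ hij)
    · exact Nat.le_sub_one_of_lt i.val_lt
    · exact Nat.le_sub_one_of_lt j.val_lt
  · intro i
    have hi : i + 1 = ((i.val + 1 : ℕ) : ZMod C.length) := by simp
    have hadj := C.adj_getVert_succ i.val_lt
    rw [hi, ZMod.val_natCast]
    -- The last index wraps around to `0`, where the closed walk returns to its start.
    rcases (Nat.succ_le_of_lt i.val_lt).lt_or_eq with h | h
    · rwa [Nat.mod_eq_of_lt h]
    · rw [Nat.succ_eq_add_one] at h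
      rw [h, SimpleGraph.Walk.getVert_length] at hadj
      rw [h, Nat.mod_self, SimpleGraph.Walk.getVert_zero]
      exact hadj
  · ext w
    simp only [Set.mem_range, SimpleGraph.Walk.verts, Set.mem_ofPred_eq,
      SimpleGraph.Walk.mem_support_iff_exists_getVert]
    constructor
    · rintro ⟨i, rfl⟩
      exact ⟨i.val, rfl, i.val_lt.le⟩
    · rintro ⟨n, rfl, hn⟩
      rcases hn.lt_or_eq with h | h
      · exact ⟨n, by rw [ZMod.val_natCast_of_lt h]⟩
      · exact ⟨0, by rw [ZMod.val_zero, h, SimpleGraph.Walk.getVert_zero,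
          SimpleGraph.Walk.getVert_length]⟩
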